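/- Fix real numbers $\sigma_x^2>0$ and $N>0$; logarithms are to base $2$. For random vectors $X,Y$ let $I(X;Y)$ be their mutual information (the Kullback–Leibler divergence, in bits, of the joint law from the product of the marginal laws; with joint density $p_{X,Y}$ this is $\int p_{X,Y}\log\frac{p_{X,Y}}{p_X p_Y}$), and for real processes put $I_\infty(x;y)=\limsup_{k\to\infty}\frac{1}{k+1}I(x_0,\dots,x_k;y_0,\dots,y_k)$. Let $\{x_k\}_{k\ge 0}$ be a zero-mean stationary white Gaussian process with variance $\sigma_x^2$, that is, a Gaussian process with $\mathbb E[x_k]=0$, $\mathbb E[x_k^2]=\sigma_x^2$ and $\mathbb E[x_ix_j]=0$ for $i\ne j$. Consider the scalar channel $y_k=x_k+z_k$, where the real noise process $\{z_k\}_{k\ge 0}$ is independent of $\{x_k\}$. The channel leakage with noise power constraint $N$ is $$L=\inf I_\infty(x;y),$$ the infimum being over the laws of all zero-mean noise processes $\{z_k\}$ such that $(z_0,\dots,z_k)$ has a density and $\mathbb E[z_k^2]\le N$ for every $k$. Then $$L=\frac12\log_2\left(1+\frac{\sigma_x^2}{N}\right).$$ Moreover the infimum is attained: zero-mean stationary white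 Gaussian noise of variance $N$ exists and is admissible, and for it $I_\infty(x;y)=L$. -/

import Mathlib

open MeasureTheory ProbabilityTheory Filter
open scoped ENNReal

/-- The mutual information `I(X; Y)`, in bits, of two random vectors on `(Ω, P)`: the
Kullback-Leibler divergence of the joint law from the product of the marginal laws. `klDiv` is
`∫ log (dμ/dν) dμ` in nats for probability measures, with value `∞` when the integral is
infinite; if `(X, Y)` has a joint density this is `∫ p_{X,Y} log (p_{X,Y} / (p_X p_Y))`. -/
noncomputable def mutualInfo {Ω α β : Type*} [MeasurableSpace Ω] [MeasurableSpace α]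
    [MeasurableSpace β] (P : Measure Ω) (X : Ω → α) (Y : Ω → β) : ℝ≥0∞ :=
  InformationTheory.klDiv (P.map fun ω => (X ω, Y ω)) ((P.map X).prod (P.map Y))
    / ENNReal.ofReal (Real.log 2)

/-- The mutual information rate `limsup_k I(x_0,…,x_k ; y_0,…,y_k) / (k+1)`, in bits, of two
real stochastic processes. -/
noncomputable def mutualInfoRate {Ω : Type*} [MeasurableSpace Ω] (P : Measure Ω)
    (x y : ℕ → Ω → ℝ) : ℝ≥0∞ :=
  limsup (fun k : ℕ =>
    mutualInfo P (fun ω (i : Fin (k + 1)) => x i ω) (fun ω (i : Fin (k + 1)) => y i ω)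
      / ((k + 1 : ℕ) : ℝ≥0∞)) atTop

/-- `x` is a (zero-mean) stationary white Gaussian process with variance `v`: a Gaussian process
with `E[x_i x_j] = v` if `i = j` and `0` otherwise. -/
structure IsWhiteGaussian {Ω : Type*} [MeasurableSpace Ω] (x : ℕ → Ω → ℝ) (v : ℝ)
    (P : Measure Ω) : Prop where
  gaussian : IsGaussianProcess x P
  mean_zero : ∀ k, ∫ ω, x k ω ∂P = 0
  correlation : ∀ i j, ∫ ω, x i ω * x j ω ∂P = if i = j then v else 0

/-- `ν` is the law of an admissible noise process: `(z_0, …, z_k)` has a density for every `k`,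
the process is zero-mean, and it satisfies the power constraint `E[z_k ^ 2] ≤ N` for every `k`. -/
structure IsNoiseLaw (N : ℝ) (ν : Measure (ℕ → ℝ)) : Prop where
  prob : IsProbabilityMeasure ν
  density : ∀ k : ℕ, ν.map (fun z (i : Fin (k + 1)) => z i) ≪ volume
  sq_integrable : ∀ k : ℕ, MemLp (fun z : ℕ → ℝ => z k) 2 ν
  mean_zero : ∀ k : ℕ, ∫ z, z k ∂ν = 0
  power_le : ∀ k : ℕ, ∫ z, z k ^ 2 ∂ν ≤ N

/-- The mutual information rate `I_∞(x; y)` of the additive channel `y_k = x_k + z_k` whose input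
process has law `μ` and whose noise process has law `ν` and is independent of the input. -/
noncomputable def channelInfoRate (μ ν : Measure (ℕ → ℝ)) : ℝ≥0∞ :=
  mutualInfoRate (μ.prod ν) (fun k p => p.1 k) (fun k p => p.1 k + p.2 k)

/-- The channel leakage under the noise power constraint `E[z_k ^ 2] ≤ N`: the infimum of the
mutual information rate over the laws of admissible noise processes. -/
noncomputable def channelLeakage (μ : Measure (ℕ → ℝ)) (N : ℝ) : ℝ≥0∞ :=
  ⨅ (ν : Measure (ℕ → ℝ)) (_ : IsNoiseLaw N ν), channelInfoRate μ ν

open InformationTheory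
open scoped NNReal

/-- Variational lower bound of Donsker and Varadhan, for a normalized exponential. -/
lemma ofReal_integral_le_klDiv {α : Type*} [MeasurableSpace α] {μ ν : Measure α}
    [IsProbabilityMeasure μ] [IsProbabilityMeasure ν] {f : α → ℝ} (hfμ : Integrable f μ)
    (hfν : Integrable (fun x => Real.exp (f x)) ν) (h_one : ∫ x, Real.exp (f x) ∂ν = 1) :
    ENNReal.ofReal (∫ x, f x ∂μ) ≤ klDiv μ ν := by
  by_cases h : klDiv μ ν = ∞
  · simp [h]
  obtain ⟨hac, hint⟩ := klDiv_ne_top_iff.mp h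
  have := isProbabilityMeasure_tilted hfν
  have hnn := integral_llr_add_sub_measure_univ_nonneg
    (hac.trans (absolutelyContinuous_tilted hfν)) (integrable_llr_tilted_right hac hfμ hint hfν)
  rw [integral_llr_tilted_right hac hfμ hfν hint, h_one] at hnn
  simp only [Real.log_one, add_zero, probReal_univ, add_sub_cancel_right] at hnn
  rw [klDiv_of_ac_of_integrable hac hint]
  refine ENNReal.ofReal_le_ofReal ?_
  simp only [probReal_univ, add_sub_cancel_right]
  linarith

lemma klDiv_prod_le {α β : Type*} [MeasurableSpace α] [MeasurableSpace β] (μ ν : Measure α)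
    (ρ σ : Measure β) [IsProbabilityMeasure μ] [IsProbabilityMeasure ν] [IsProbabilityMeasure ρ]
    [IsProbabilityMeasure σ] :
    klDiv (μ.prod ρ) (ν.prod σ) ≤ klDiv μ ν + klDiv ρ σ := by
  have h := klDiv_compProd_eq_add μ ν (Kernel.const α ρ) (Kernel.const α σ)
  simp only [Measure.compProd_const] at h
  rw [h]
  gcongr
  calc klDiv (μ.prod ρ) (μ.prod σ)
      = klDiv ((ρ.prod μ).map Prod.swap) ((σ.prod μ).map Prod.swap) := by
        rw [Measure.prod_swap, Measure.prod_swap]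
    _ ≤ klDiv (ρ.prod μ) (σ.prod μ) := klDiv_map_le _ _ measurable_swap
    _ = klDiv ρ σ := by
        rw [← Measure.compProd_const, ← Measure.compProd_const, klDiv_compProd_left]

lemma klDiv_pi_le {α : Type*} [MeasurableSpace α] (μ ν : Measure α)
    [IsProbabilityMeasure μ] [IsProbabilityMeasure ν] (n : ℕ) :
    klDiv (Measure.pi fun _ : Fin n => μ) (Measure.pi fun _ : Fin n => ν) ≤ n * klDiv μ ν := by
  induction n with
  | zero =>
    rw [Measure.pi_of_empty (fun _ : Fin 0 => μ), Measure.pi_of_empty (fun _ : Fin 0 => ν)]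
    simp
  | succ n ih =>
    have hμ := (measurePreserving_piFinSuccAbove (fun _ : Fin (n + 1) => μ) 0).symm.map_eq
    have hν := (measurePreserving_piFinSuccAbove (fun _ : Fin (n + 1) => ν) 0).symm.map_eq
    rw [← hμ, ← hν]
    refine (klDiv_map_le _ _ (MeasurableEquiv.measurable _)).trans
      ((klDiv_prod_le _ _ _ _).trans ?_)
    push_cast
    rw [add_mul, one_mul, add_comm]
    gcongr

/-- The log-likelihood ratio of the joint law of the input and output of a Gaussian channel with
input variance `v` and noise variance `N` with respect to the product of the marginals. -/
noncomputable def gaussianChannelLlr (v N : ℝ≥0) (a b : ℝ) : ℝ :=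
  1 / 2 * Real.log (1 + v / N) - (b - a) ^ 2 / (2 * N) + b ^ 2 / (2 * (v + N))

@[fun_prop]
lemma measurable_gaussianChannelLlr (v N : ℝ≥0) :
    Measurable (fun p : ℝ × ℝ => gaussianChannelLlr v N p.1 p.2) := by
  unfold gaussianChannelLlr
  fun_prop

lemma exp_half_log {t : ℝ} (ht : 0 < t) : Real.exp (1 / 2 * Real.log t) = √t := by
  rw [Real.sqrt_eq_rpow, Real.rpow_def_of_pos ht, mul_comm]

lemma exp_gaussianChannelLlr {v N : ℝ≥0} (a b : ℝ) :
    Real.exp (gaussianChannelLlr v N a b) = √(1 + v / N) *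
      Real.exp (-((b - a) ^ 2 / (2 * N) - b ^ 2 / (2 * (v + N)))) := by
  rw [← exp_half_log (by positivity), ← Real.exp_add, gaussianChannelLlr]
  congr 1
  ring

lemma gaussianPDFReal_output {v N : ℝ≥0} (hN : N ≠ 0) (a b : ℝ) :
    gaussianPDFReal a N b
      = gaussianPDFReal 0 (v + N) b * Real.exp (gaussianChannelLlr v N a b) := by
  have hN' : (0 : ℝ) < N := by positivity
  have hv' : (0 : ℝ) ≤ v := by positivity
  have hsq : √(2 * Real.pi * (v + N)) = √(2 * Real.pi * N) * √(1 + v / N) := by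
    rw [← Real.sqrt_mul (by positivity)]
    congr 1
    field_simp
    ring
  rw [gaussianPDFReal, gaussianPDFReal, exp_gaussianChannelLlr, NNReal.coe_add, hsq]
  have h1 : √(1 + (v : ℝ) / N) ≠ 0 := by positivity
  have h2 : √(2 * Real.pi * (N : ℝ)) ≠ 0 := by positivity
  calc _ = (√(2 * Real.pi * N))⁻¹ * (Real.exp (-(b - 0) ^ 2 / (2 * (v + N)))
        * Real.exp (-((b - a) ^ 2 / (2 * N) - b ^ 2 / (2 * (v + N))))) := by
        rw [← Real.exp_add]
        congr 2
        ring
    _ = _ := by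
        field_simp

lemma gaussianPDFReal_backward {v N : ℝ≥0} (hv : v ≠ 0) (hN : N ≠ 0) (a b : ℝ) :
    gaussianPDFReal 0 v a * Real.exp (gaussianChannelLlr v N a b)
      = gaussianPDFReal (v / (v + N) * b) (v * N / (v + N)) a := by
  have hN' : (0 : ℝ) < N := by positivity
  have hv' : (0 : ℝ) < v := by positivity
  have hsq : √(2 * Real.pi * v) = √(2 * Real.pi * (v * N / (v + N))) * √(1 + v / N) := by
    rw [← Real.sqrt_mul (by positivity)]
    congr 1
    field_simp
    ring
  rw [gaussianPDFReal, gaussianPDFReal, exp_gaussianChannelLlr, NNReal.coe_div, NNReal.coe_mul, NNReal.coe_add, hsq]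
  have h1 : √(1 + (v : ℝ) / N) ≠ 0 := by positivity
  have h2 : √(2 * Real.pi * ((v : ℝ) * N / (v + N))) ≠ 0 := by positivity
  calc _ = (√(2 * Real.pi * (v * N / (v + N))))⁻¹ * (Real.exp (-(a - 0) ^ 2 / (2 * v))
        * Real.exp (-((b - a) ^ 2 / (2 * N) - b ^ 2 / (2 * (v + N))))) := by
        field_simp
    _ = _ := by
        rw [← Real.exp_add]
        congr 2
        field_simp
        ring

lemma integrable_exp_gaussianChannelLlr {v N : ℝ≥0} (hv : v ≠ 0) (hN : N ≠ 0) (b : ℝ) :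
    Integrable (fun a => Real.exp (gaussianChannelLlr v N a b)) (gaussianReal 0 v) := by
  rw [gaussianReal_of_var_ne_zero _ hv, integrable_withDensity_iff_integrable_smul'
    (measurable_gaussianPDF _ _) (ae_of_all _ fun _ => gaussianPDF_lt_top)]
  simp only [toReal_gaussianPDF, smul_eq_mul, gaussianPDFReal_backward hv hN]
  exact integrable_gaussianPDFReal _ _

lemma integral_exp_gaussianChannelLlr {v N : ℝ≥0} (hv : v ≠ 0) (hN : N ≠ 0) (b : ℝ) :
    ∫ a, Real.exp (gaussianChannelLlr v N a b) ∂(gaussianReal 0 v) = 1 := by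
  rw [integral_gaussianReal_eq_integral_smul hv]
  simp only [smul_eq_mul, gaussianPDFReal_backward hv hN]
  refine integral_gaussianPDFReal_eq_one _ ?_
  positivity

/-- The joint law of the input and output of the scalar Gaussian channel. -/
lemma gaussianChannel_joint {v N : ℝ≥0} (hN : N ≠ 0) :
    ((gaussianReal 0 v).prod (gaussianReal 0 N)).map (fun p => (p.1, p.1 + p.2))
      = ((gaussianReal 0 v).prod (gaussianReal 0 (v + N))).withDensity
          fun p => ENNReal.ofReal (Real.exp (gaussianChannelLlr v N p.1 p.2)) := by
  have hvN : v + N ≠ 0 := by positivity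
  refine Measure.ext_of_lintegral _ fun φ hφ => ?_
  rw [lintegral_map hφ (by fun_prop), lintegral_prod _ (by fun_prop),
    lintegral_withDensity_eq_lintegral_mul _ (by fun_prop) hφ,
    lintegral_prod _ (by fun_prop)]
  refine lintegral_congr fun a => ?_
  have hmap : ∫⁻ z, φ (a, a + z) ∂(gaussianReal 0 N) = ∫⁻ y, φ (a, y) ∂(gaussianReal a N) := by
    have := gaussianReal_map_const_add (μ := 0) (v := N) a
    rw [zero_add] at this
    rw [← this, lintegral_map (by fun_prop) (by fun_prop)]
  simp only [hmap, Pi.mul_apply]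
  rw [gaussianReal_of_var_ne_zero _ hN, gaussianReal_of_var_ne_zero _ hvN,
    lintegral_withDensity_eq_lintegral_mul _ (by fun_prop) (by fun_prop),
    lintegral_withDensity_eq_lintegral_mul _ (by fun_prop) (by fun_prop)]
  refine lintegral_congr fun y => ?_
  simp only [Pi.mul_apply, gaussianPDF]
  rw [gaussianPDFReal_output (v := v) hN, ENNReal.ofReal_mul (gaussianPDFReal_nonneg _ _ _),
    mul_assoc]

lemma integrable_gaussianChannelLlr {Ω : Type*} [MeasurableSpace Ω] {P : Measure Ω}
    [IsFiniteMeasure P] (v N : ℝ≥0) {X Z : Ω → ℝ} (hX : MemLp X 2 P) (hZ : MemLp Z 2 P) :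
    Integrable (fun ω => gaussianChannelLlr v N (X ω) (X ω + Z ω)) P := by
  have h1 := hZ.integrable_sq
  have h2 := (hX.add hZ).integrable_sq
  simp only [gaussianChannelLlr, add_sub_cancel_left]
  exact ((integrable_const _).sub (h1.div_const _)).add (h2.div_const _)

lemma integral_gaussianChannelLlr {Ω : Type*} [MeasurableSpace Ω] {P : Measure Ω}
    [IsProbabilityMeasure P] (v N : ℝ≥0) {X Z : Ω → ℝ} (hX : MemLp X 2 P) (hZ : MemLp Z 2 P)
    (hXX : ∫ ω, X ω ^ 2 ∂P = v) (hXZ : ∫ ω, X ω * Z ω ∂P = 0) :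
    ∫ ω, gaussianChannelLlr v N (X ω) (X ω + Z ω) ∂P
      = 1 / 2 * Real.log (1 + v / N) - (∫ ω, Z ω ^ 2 ∂P) / (2 * N)
        + (v + ∫ ω, Z ω ^ 2 ∂P) / (2 * (v + N)) := by
  have h1 := hZ.integrable_sq
  have h2 := hX.integrable_sq
  have h12 : Integrable (fun ω => X ω * Z ω) P := hX.integrable_mul hZ
  have hsum : ∫ ω, (X ω + Z ω) ^ 2 ∂P = v + ∫ ω, Z ω ^ 2 ∂P := by
    have : ∀ ω, (X ω + Z ω) ^ 2 = X ω ^ 2 + 2 * (X ω * Z ω) + Z ω ^ 2 := fun ω => by ring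
    simp only [this]
    have h4 : Integrable (fun ω => X ω ^ 2 + 2 * (X ω * Z ω)) P := h2.add (h12.const_mul 2)
    rw [integral_add h4 h1, integral_add h2 (h12.const_mul 2),
      integral_const_mul, hXX, hXZ]
    ring
  have h3 : Integrable (fun ω => (X ω + Z ω) ^ 2) P := (hX.add hZ).integrable_sq
  have h4 : Integrable (fun ω => 1 / 2 * Real.log (1 + v / N) - Z ω ^ 2 / (2 * N)) P :=
    (integrable_const _).sub (h1.div_const _)
  simp only [gaussianChannelLlr, add_sub_cancel_left]
  rw [integral_add h4 (h3.div_const _),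
    integral_sub (integrable_const _) (h1.div_const _), integral_div, integral_div, hsum]
  simp

lemma le_integral_gaussianChannelLlr {Ω : Type*} [MeasurableSpace Ω] {P : Measure Ω}
    [IsProbabilityMeasure P] {v N : ℝ≥0} (hN : N ≠ 0) {X Z : Ω → ℝ} (hX : MemLp X 2 P)
    (hZ : MemLp Z 2 P) (hXX : ∫ ω, X ω ^ 2 ∂P = v) (hXZ : ∫ ω, X ω * Z ω ∂P = 0)
    (hZZ : ∫ ω, Z ω ^ 2 ∂P ≤ N) :
    1 / 2 * Real.log (1 + v / N) ≤ ∫ ω, gaussianChannelLlr v N (X ω) (X ω + Z ω) ∂P := by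
  rw [integral_gaussianChannelLlr v N hX hZ hXX hXZ]
  have hN' : (0 : ℝ) < N := by positivity
  have hv' : (0 : ℝ) ≤ v := by positivity
  generalize ∫ ω, Z ω ^ 2 ∂P = s at hZZ ⊢
  have : (v + s) / (2 * (v + N)) - s / (2 * N) = v * (N - s) / (2 * N * (v + N)) := by
    field_simp
    ring
  have h0 : 0 ≤ v * (N - s) / (2 * N * ((v : ℝ) + N)) := by
    have : 0 ≤ (N : ℝ) - s := by linarith
    positivity
  linarith

lemma integral_sq_gaussianReal_zero (v : ℝ≥0) : ∫ x, x ^ 2 ∂(gaussianReal 0 v) = v := by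
  have h := variance_of_integral_eq_zero (μ := gaussianReal 0 v) (X := fun x : ℝ => x)
    (by fun_prop) integral_id_gaussianReal
  rw [← h, variance_fun_id_gaussianReal]

lemma memLp_two_gaussianReal (v : ℝ≥0) : MemLp (fun x : ℝ => x) 2 (gaussianReal 0 v) :=
  memLp_id_gaussianReal 2

/-- Information between the input and the output of the scalar Gaussian channel, in nats. -/
lemma klDiv_gaussianChannel {v N : ℝ≥0} (hN : N ≠ 0) :
    klDiv (((gaussianReal 0 v).prod (gaussianReal 0 N)).map (fun p => (p.1, p.1 + p.2)))
      ((gaussianReal 0 v).prod (gaussianReal 0 (v + N)))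
      = ENNReal.ofReal (1 / 2 * Real.log (1 + v / N)) := by
  set J := ((gaussianReal 0 v).prod (gaussianReal 0 N)).map (fun p => (p.1, p.1 + p.2)) with hJ
  set R := (gaussianReal 0 v).prod (gaussianReal 0 (v + N)) with hR
  have hT : Measurable fun p : ℝ × ℝ => (p.1, p.1 + p.2) := by fun_prop
  have : IsProbabilityMeasure J := Measure.isProbabilityMeasure_map hT.aemeasurable
  have hJR : J = R.withDensity
      fun p => ENNReal.ofReal (Real.exp (gaussianChannelLlr v N p.1 p.2)) :=
    gaussianChannel_joint hN
  have hac : J ≪ R := hJR ▸ withDensity_absolutelyContinuous _ _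
  have hllr : llr J R =ᵐ[J] fun p => gaussianChannelLlr v N p.1 p.2 := by
    have h := Measure.rnDeriv_withDensity R
      (f := fun p => ENNReal.ofReal (Real.exp (gaussianChannelLlr v N p.1 p.2))) (by fun_prop)
    rw [← hJR] at h
    filter_upwards [hac.ae_le h] with p hp
    rw [llr, hp, ENNReal.toReal_ofReal (Real.exp_nonneg _), Real.log_exp]
  have hX : MemLp (fun p : ℝ × ℝ => p.1) 2 ((gaussianReal 0 v).prod (gaussianReal 0 N)) :=
    (memLp_two_gaussianReal v).comp_fst _
  have hZ : MemLp (fun p : ℝ × ℝ => p.2) 2 ((gaussianReal 0 v).prod (gaussianReal 0 N)) :=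
    (memLp_two_gaussianReal N).comp_snd _
  have hint : Integrable (fun p : ℝ × ℝ => gaussianChannelLlr v N p.1 p.2) J := by
    rw [hJ, integrable_map_measure (by fun_prop) hT.aemeasurable]
    exact integrable_gaussianChannelLlr v N hX hZ
  have hXX : ∫ p : ℝ × ℝ, p.1 ^ 2 ∂((gaussianReal 0 v).prod (gaussianReal 0 N)) = v := by
    rw [integral_fun_fst (fun x : ℝ => x ^ 2), integral_sq_gaussianReal_zero]
    simp
  have hZZ : ∫ p : ℝ × ℝ, p.2 ^ 2 ∂((gaussianReal 0 v).prod (gaussianReal 0 N)) = N := by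
    rw [integral_fun_snd (fun x : ℝ => x ^ 2), integral_sq_gaussianReal_zero]
    simp
  have hXZ : ∫ p : ℝ × ℝ, p.1 * p.2 ∂((gaussianReal 0 v).prod (gaussianReal 0 N)) = 0 := by
    rw [integral_prod_mul (fun x : ℝ => x) (fun x : ℝ => x), integral_id_gaussianReal, zero_mul]
  rw [klDiv_of_ac_of_integrable hac ((integrable_congr hllr).mpr hint), integral_congr_ae hllr,
    hJ, integral_map hT.aemeasurable (by fun_prop), ← hJ,
    integral_gaussianChannelLlr v N hX hZ hXX hXZ, hZZ]
  simp only [probReal_univ, add_sub_cancel_right]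
  have hN' : (0 : ℝ) < N := by positivity
  have hv' : (0 : ℝ) ≤ v := by positivity
  congr 1
  field_simp
  ring

/-- The Gaussian backward channel gives a lower bound for the information between a white Gaussian
input and the output of an additive channel with power-limited uncorrelated noise. -/
lemma le_klDiv_additive_channel {Ω : Type*} [MeasurableSpace Ω] {P : Measure Ω}
    [IsProbabilityMeasure P] {n : ℕ} {v N : ℝ≥0} (hv : v ≠ 0) (hN : N ≠ 0)
    {X Z : Ω → Fin n → ℝ} (hXm : Measurable X) (hZm : Measurable Z)
    (hX : P.map X = Measure.pi fun _ => gaussianReal 0 v)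
    (hZ : ∀ i, MemLp (fun ω => Z ω i) 2 P)
    (hXZ : ∀ i, ∫ ω, X ω i * Z ω i ∂P = 0) (hZZ : ∀ i, ∫ ω, Z ω i ^ 2 ∂P ≤ N) :
    ENNReal.ofReal (n * (1 / 2 * Real.log (1 + v / N)))
      ≤ klDiv (P.map fun ω => (X ω, fun i => X ω i + Z ω i))
          ((P.map X).prod (P.map fun ω i => X ω i + Z ω i)) := by
  have hYm : Measurable fun ω i => X ω i + Z ω i := by fun_prop
  have hTm : Measurable fun ω => (X ω, fun i => X ω i + Z ω i) := hXm.prodMk hYm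
  have := Measure.isProbabilityMeasure_map (μ := P) hYm.aemeasurable
  have := Measure.isProbabilityMeasure_map (μ := P) hTm.aemeasurable
  have hXi (i : Fin n) : P.map (fun ω => X ω i) = gaussianReal 0 v := by
    have : (fun ω => X ω i) = Function.eval i ∘ X := rfl
    rw [this, ← Measure.map_map (measurable_pi_apply i) hXm, hX,
      (measurePreserving_eval (fun _ : Fin n => gaussianReal 0 v) i).map_eq]
  have hX2 (i : Fin n) : MemLp (fun ω => X ω i) 2 P := by
    have h := memLp_two_gaussianReal v
    rw [← hXi i] at h
    exact h.comp_of_map (f := fun ω => X ω i) (by fun_prop)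
  have hXX (i : Fin n) : ∫ ω, X ω i ^ 2 ∂P = v := by
    rw [← integral_sq_gaussianReal_zero v, ← hXi i, integral_map (by fun_prop) (by fun_prop)]
  set g : (Fin n → ℝ) × (Fin n → ℝ) → ℝ := fun p => ∑ i, gaussianChannelLlr v N (p.1 i) (p.2 i)
    with hg
  have hgm : Measurable g := by
    refine Finset.measurable_sum _ fun i _ => ?_
    exact (measurable_gaussianChannelLlr v N).comp
      (f := fun p : (Fin n → ℝ) × (Fin n → ℝ) => (p.1 i, p.2 i)) (by fun_prop)
  have hgi (i : Fin n) := integrable_gaussianChannelLlr v N (hX2 i) (hZ i)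
  have hexp (x y : Fin n → ℝ) :
      Real.exp (g (x, y)) = ∏ i, Real.exp (gaussianChannelLlr v N (x i) (y i)) := by
    rw [hg, Real.exp_sum]
  have hone (y : Fin n → ℝ) :
      ∫ x, Real.exp (g (x, y)) ∂(Measure.pi fun _ => gaussianReal 0 v) = 1 := by
    simp only [hexp]
    rw [integral_fintype_prod_eq_prod
      (fun (i : Fin n) (a : ℝ) => Real.exp (gaussianChannelLlr v N a (y i)))]
    simp only [integral_exp_gaussianChannelLlr hv hN, Finset.prod_const_one]
  have hint : Integrable (fun p => Real.exp (g p))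
      ((P.map X).prod (P.map fun ω i => X ω i + Z ω i)) := by
    rw [hX, integrable_prod_iff' (by fun_prop)]
    refine ⟨ae_of_all _ fun y => ?_, ?_⟩
    · simp only [hexp]
      exact Integrable.fintype_prod
        (f := fun (i : Fin n) (a : ℝ) => Real.exp (gaussianChannelLlr v N a (y i)))
        fun i => integrable_exp_gaussianChannelLlr hv hN (y i)
    · simp only [Real.norm_eq_abs, Real.abs_exp, hone]
      exact integrable_const _
  have : IsProbabilityMeasure (P.map X) := Measure.isProbabilityMeasure_map hXm.aemeasurable
  refine le_trans ?_ (ofReal_integral_le_klDiv (f := g) ?_ hint ?_)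
  · refine ENNReal.ofReal_le_ofReal ?_
    rw [integral_map hTm.aemeasurable (by fun_prop), hg, integral_finsetSum _ fun i _ => hgi i]
    calc _ = ∑ _i : Fin n, 1 / 2 * Real.log (1 + (v : ℝ) / N) := by simp
      _ ≤ _ := Finset.sum_le_sum fun i _ =>
        le_integral_gaussianChannelLlr hN (hX2 i) (hZ i) (hXX i) (hXZ i) (hZZ i)
  · rw [integrable_map_measure (by fun_prop) hTm.aemeasurable]
    exact integrable_finsetSum _ fun i _ => hgi i
  · rw [integral_prod_symm _ hint, hX]
    simp [hone]

/-- The information through the parallel Gaussian channel is at most the sum of the information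
through its components. -/
lemma klDiv_gaussian_channel_le {Ω : Type*} [MeasurableSpace Ω] {P : Measure Ω}
    {n : ℕ} {v N : ℝ≥0} (hN : N ≠ 0)
    {X Z : Ω → Fin n → ℝ} (hXm : Measurable X) (hZm : Measurable Z)
    (hXZ : P.map (fun ω => (X ω, Z ω))
      = (Measure.pi fun _ => gaussianReal 0 v).prod (Measure.pi fun _ => gaussianReal 0 N)) :
    klDiv (P.map fun ω => (X ω, fun i => X ω i + Z ω i))
        ((P.map X).prod (P.map fun ω i => X ω i + Z ω i))
      ≤ n * ENNReal.ofReal (1 / 2 * Real.log (1 + v / N)) := by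
  set e := MeasurableEquiv.arrowProdEquivProdArrow ℝ ℝ (Fin n) with he
  have he_apply (w : Fin n → ℝ × ℝ) : e w = (fun i => (w i).1, fun i => (w i).2) := rfl
  have hem : Measurable e := e.measurable
  set γ := gaussianReal 0 v
  set γ' := gaussianReal 0 N
  have hpair : Measurable fun ω => (X ω, Z ω) := hXm.prodMk hZm
  have hW : P.map (fun ω => (X ω, Z ω)) = (Measure.pi fun _ : Fin n => γ.prod γ').map e := by
    rw [hXZ, (measurePreserving_arrowProdEquivProdArrow ℝ ℝ (Fin n) (fun _ => γ)
      (fun _ => γ')).map_eq]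
  have hJ : P.map (fun ω => (X ω, fun i => X ω i + Z ω i))
      = (Measure.pi fun _ : Fin n => (γ.prod γ').map fun p => (p.1, p.1 + p.2)).map e := by
    have h1 : P.map (fun ω => (X ω, fun i => X ω i + Z ω i))
        = (P.map (fun ω => (X ω, Z ω))).map fun p => (p.1, fun i => p.1 i + p.2 i) := by
      rw [Measure.map_map (by fun_prop) hpair]
      rfl
    rw [h1, hW, Measure.map_map (by fun_prop) hem]
    rw [← Measure.pi_map_pi (f := fun (_ : Fin n) (p : ℝ × ℝ) => (p.1, p.1 + p.2))
      (fun _ => by fun_prop), Measure.map_map hem (by fun_prop)]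
    rfl
  have hX : P.map X = Measure.pi fun _ => γ := by
    have : X = Prod.fst ∘ fun ω => (X ω, Z ω) := rfl
    rw [this, ← Measure.map_map measurable_fst hpair, hXZ]
    simp [Measure.map_fst_prod]
  have hY : P.map (fun ω i => X ω i + Z ω i)
      = Measure.pi fun _ => gaussianReal 0 (v + N) := by
    have h1 : P.map (fun ω i => X ω i + Z ω i)
        = (P.map (fun ω => (X ω, Z ω))).map fun p i => p.1 i + p.2 i := by
      rw [Measure.map_map (by fun_prop) hpair]
      rfl
    have h2 : gaussianReal 0 (v + N) = (γ.prod γ').map fun p => p.1 + p.2 := by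
      have := gaussianReal_conv_gaussianReal (m₁ := 0) (m₂ := 0) (v₁ := v) (v₂ := N)
      rw [add_zero] at this
      rw [← this, Measure.conv]
    rw [h1, hW, Measure.map_map (by fun_prop) hem, h2]
    have := Measure.isProbabilityMeasure_map (μ := γ.prod γ') (f := fun p => p.1 + p.2)
      (by fun_prop)
    rw [← Measure.pi_map_pi (f := fun (_ : Fin n) (p : ℝ × ℝ) => p.1 + p.2)
      (fun _ => by fun_prop)]
    rfl
  have := Measure.isProbabilityMeasure_map (μ := γ.prod γ') (f := fun p => (p.1, p.1 + p.2))
      (by fun_prop)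
  rw [hX, hY, hJ, ← (measurePreserving_arrowProdEquivProdArrow ℝ ℝ (Fin n) (fun _ => γ)
      (fun _ => gaussianReal 0 (v + N))).map_eq, ← klDiv_gaussianChannel hN]
  exact (klDiv_map_le _ _ hem).trans (klDiv_pi_le _ _ n)

lemma pi_absolutelyContinuous {α : Type*} [MeasurableSpace α] {μ ν : Measure α} [SigmaFinite μ]
    [SigmaFinite ν] (h : μ ≪ ν) (n : ℕ) :
    (Measure.pi fun _ : Fin n => μ) ≪ Measure.pi fun _ : Fin n => ν := by
  induction n with
  | zero =>
    rw [Measure.pi_of_empty (fun _ : Fin 0 => μ), Measure.pi_of_empty (fun _ : Fin 0 => ν)]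
  | succ n ih =>
    have hμ := (measurePreserving_piFinSuccAbove (fun _ : Fin (n + 1) => μ) 0).symm.map_eq
    have hν := (measurePreserving_piFinSuccAbove (fun _ : Fin (n + 1) => ν) 0).symm.map_eq
    rw [← hμ, ← hν]
    exact (h.prod ih).map (MeasurableEquiv.measurable _)

namespace IsWhiteGaussian

variable {Ω : Type*} [MeasurableSpace Ω] {P : Measure Ω} {x : ℕ → Ω → ℝ} {v : ℝ≥0}

lemma hasGaussianLaw_fin (hx : IsWhiteGaussian x v P) (n : ℕ) :
    HasGaussianLaw (fun ω (i : Fin n) => x i ω) P :=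
  (hx.gaussian.hasGaussianLaw (Finset.range n)).map_fun
    (ContinuousLinearMap.pi fun i : Fin n =>
      ContinuousLinearMap.proj (R := ℝ) (φ := fun _ : Finset.range n => ℝ)
        ⟨i, Finset.mem_range.mpr i.isLt⟩)

lemma map_eval (hx : IsWhiteGaussian x v P) (i : ℕ) : P.map (x i) = gaussianReal 0 v := by
  have h := (hx.gaussian.hasGaussianLaw_eval i).map_eq_gaussianReal
  rw [variance_of_integral_eq_zero (hx.gaussian.aemeasurable i) (hx.mean_zero i),
    hx.mean_zero i] at h
  have hc := hx.correlation i i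
  simp only [if_true, ← pow_two] at hc
  rw [h, hc, Real.toNNReal_coe]

lemma map_fin (hx : IsWhiteGaussian x v P) (n : ℕ) :
    P.map (fun ω (i : Fin n) => x i ω) = Measure.pi fun _ => gaussianReal 0 v := by
  have := hx.gaussian.isProbabilityMeasure
  have hind : iIndepFun (fun (i : Fin n) => x i) P := by
    refine (hx.hasGaussianLaw_fin n).iIndepFun_of_covariance_eq_zero fun i j hij => ?_
    rw [covariance_eq_sub (hx.gaussian.hasGaussianLaw_eval i).memLp_two
      (hx.gaussian.hasGaussianLaw_eval j).memLp_two]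
    have hc := hx.correlation i j
    rw [if_neg (fun h => hij (Fin.ext h))] at hc
    simp only [Pi.mul_apply, hc, hx.mean_zero, mul_zero, sub_zero]
  rw [(iIndepFun_iff_map_fun_eq_pi_map fun i : Fin n => hx.gaussian.aemeasurable i).mp hind]
  simp only [hx.map_eval]

lemma map_process_fin (hx : IsWhiteGaussian x v P) (n : ℕ) :
    (P.map fun ω k => x k ω).map (fun (z : ℕ → ℝ) (i : Fin n) => z i)
      = Measure.pi fun _ => gaussianReal 0 v := by
  rw [AEMeasurable.map_map_of_aemeasurable (Measurable.aemeasurable (by fun_prop))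
    (aemeasurable_pi_lambda _ hx.gaussian.aemeasurable)]
  exact hx.map_fin n

end IsWhiteGaussian

lemma IsWhiteGaussian.isNoiseLaw {N : ℝ≥0} (hN : N ≠ 0) {ν : Measure (ℕ → ℝ)}
    (h : IsWhiteGaussian (fun k z => z k) N ν) : IsNoiseLaw N ν where
  prob := h.gaussian.isProbabilityMeasure
  density k := by
    rw [h.map_fin (k + 1), volume_pi]
    exact pi_absolutelyContinuous (gaussianReal_absolutelyContinuous 0 hN) _
  sq_integrable k := (h.gaussian.hasGaussianLaw_eval k).memLp_two
  mean_zero k := h.mean_zero k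
  power_le k := by
    have := h.correlation k k
    simp only [if_true, ← pow_two] at this
    exact this.le

lemma exists_isWhiteGaussian (N : ℝ≥0) :
    ∃ ν : Measure (ℕ → ℝ), IsWhiteGaussian (fun k z => z k) N ν := by
  let ν : Measure (ℕ → ℝ) := Measure.infinitePi fun _ => gaussianReal 0 N
  have hev (k : ℕ) : ν.map (fun z => z k) = gaussianReal 0 N :=
    Measure.infinitePi_map_eval (fun _ : ℕ => gaussianReal 0 N) k
  have hgl (k : ℕ) : HasGaussianLaw (fun z : ℕ → ℝ => z k) ν :=
    ⟨by rw [hev]; infer_instance⟩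
  have hind : iIndepFun (fun (k : ℕ) (z : ℕ → ℝ) => z k) ν :=
    iIndepFun_infinitePi (P := fun _ : ℕ => gaussianReal 0 N) (X := fun _ a => a)
      fun _ => measurable_id
  have hmean (k : ℕ) : ∫ z, z k ∂ν = 0 := by
    have : ∫ a, a ∂(ν.map fun z => z k) = 0 := by rw [hev]; exact integral_id_gaussianReal
    rwa [integral_map (measurable_pi_apply k).aemeasurable (by fun_prop)] at this
  refine ⟨ν, ⟨⟨fun I => ?_⟩, hmean, fun i j => ?_⟩⟩
  · exact iIndepFun.hasGaussianLaw (fun i : I => hgl i)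
      (hind.precomp (g := fun i : I => (i : ℕ)) Subtype.val_injective)
  · split_ifs with hij
    · subst hij
      rw [← integral_sq_gaussianReal_zero N, ← hev i,
        integral_map (measurable_pi_apply i).aemeasurable (by fun_prop)]
      simp only [pow_two]
    · rw [(hind.indepFun hij).integral_fun_mul_eq_mul_integral
        (measurable_pi_apply i).aestronglyMeasurable (measurable_pi_apply j).aestronglyMeasurable,
        hmean, zero_mul]

lemma mutualInfo_eq_klDiv {Ω : Type*} [MeasurableSpace Ω] {P : Measure Ω} {α β : Type*}
    [MeasurableSpace α] [MeasurableSpace β] (X : Ω → α) (Y : Ω → β) :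
    mutualInfo P X Y = klDiv (P.map fun ω => (X ω, Y ω)) ((P.map X).prod (P.map Y))
      / ENNReal.ofReal (Real.log 2) := rfl

lemma ofReal_half_logb_eq_div {t : ℝ} (n : ℕ) :
    ENNReal.ofReal (1 / 2 * Real.logb 2 t)
      = ENNReal.ofReal ((n + 1 : ℕ) * (1 / 2 * Real.log t)) / ENNReal.ofReal (Real.log 2)
          / ((n + 1 : ℕ) : ℝ≥0∞) := by
  have h2 : 0 < Real.log 2 := Real.log_pos (by norm_num)
  rw [← ENNReal.ofReal_natCast, ← ENNReal.ofReal_div_of_pos h2,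
    ← ENNReal.ofReal_div_of_pos (by positivity)]
  congr 1
  rw [Real.logb]
  have : ((n + 1 : ℕ) : ℝ) ≠ 0 := by positivity
  field_simp

lemma le_channelInfoRate {μ ν : Measure (ℕ → ℝ)} [IsProbabilityMeasure μ] {v N : ℝ≥0} (hv : v ≠ 0)
    (hN : N ≠ 0)
    (hμ : ∀ n : ℕ, μ.map (fun z (i : Fin n) => z i) = Measure.pi fun _ => gaussianReal 0 v)
    (hν : IsNoiseLaw N ν) :
    ENNReal.ofReal (1 / 2 * Real.logb 2 (1 + v / N)) ≤ channelInfoRate μ ν := by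
  have := hν.prob
  refine le_limsup_of_frequently_le (Frequently.of_forall fun k => ?_)
  rw [ofReal_half_logb_eq_div k, mutualInfo_eq_klDiv]
  gcongr
  refine le_klDiv_additive_channel (P := μ.prod ν) hv hN
    (X := fun p (i : Fin (k + 1)) => p.1 i) (Z := fun p (i : Fin (k + 1)) => p.2 i)
    (by fun_prop) (by fun_prop) ?_ (fun i => (hν.sq_integrable i).comp_snd μ) (fun i => ?_)
    (fun i => ?_)
  · have : (fun (p : (ℕ → ℝ) × (ℕ → ℝ)) (i : Fin (k + 1)) => p.1 i)
        = (fun z (i : Fin (k + 1)) => z i) ∘ Prod.fst := rfl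
    rw [this, ← Measure.map_map (by fun_prop) measurable_fst, Measure.map_fst_prod,
      measure_univ, one_smul, hμ]
  · rw [integral_prod_mul (fun z : ℕ → ℝ => z i) (fun z : ℕ → ℝ => z i), hν.mean_zero, mul_zero]
  · rw [integral_fun_snd (fun z : ℕ → ℝ => z i ^ 2)]
    simpa using hν.power_le i

lemma channelInfoRate_le {μ ν : Measure (ℕ → ℝ)} [IsProbabilityMeasure μ] [IsProbabilityMeasure ν]
    {v N : ℝ≥0} (hN : N ≠ 0)
    (hμ : ∀ n : ℕ, μ.map (fun z (i : Fin n) => z i) = Measure.pi fun _ => gaussianReal 0 v)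
    (hν : ∀ n : ℕ, ν.map (fun z (i : Fin n) => z i) = Measure.pi fun _ => gaussianReal 0 N) :
    channelInfoRate μ ν ≤ ENNReal.ofReal (1 / 2 * Real.logb 2 (1 + v / N)) := by
  refine limsup_le_of_le (h := Eventually.of_forall fun k => ?_)
  rw [ofReal_half_logb_eq_div k, mutualInfo_eq_klDiv, ENNReal.ofReal_mul (by positivity),
    ENNReal.ofReal_natCast]
  gcongr
  refine klDiv_gaussian_channel_le (P := μ.prod ν) hN
    (X := fun p (i : Fin (k + 1)) => p.1 i) (Z := fun p (i : Fin (k + 1)) => p.2 i)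
    (by fun_prop) (by fun_prop) ?_
  rw [← hμ, ← hν, Measure.map_prod_map _ _ (by fun_prop) (by fun_prop)]
  rfl

theorem theorem2 {Ω : Type*} [MeasurableSpace Ω] (P : Measure Ω) [IsProbabilityMeasure P]
    (x : ℕ → Ω → ℝ) (v N : ℝ) (hv : 0 < v) (hN : 0 < N) (hx : IsWhiteGaussian x v P) :
    channelLeakage (P.map fun ω k => x k ω) N
        = ENNReal.ofReal (1 / 2 * Real.logb 2 (1 + v / N)) ∧
    (∃ ν : Measure (ℕ → ℝ), IsNoiseLaw N ν ∧ IsWhiteGaussian (fun k z => z k) N ν) ∧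
    (∀ ν : Measure (ℕ → ℝ), IsWhiteGaussian (fun k z => z k) N ν →
      IsNoiseLaw N ν ∧
      channelInfoRate (P.map fun ω k => x k ω) ν
        = channelLeakage (P.map fun ω k => x k ω) N) := by
  lift v to ℝ≥0 using hv.le
  lift N to ℝ≥0 using hN.le
  have hv' : v ≠ 0 := by rintro rfl; simp at hv
  have hN' : N ≠ 0 := by rintro rfl; simp at hN
  have hμ := hx.map_process_fin
  have : IsProbabilityMeasure (P.map fun ω k => x k ω) :=
    Measure.isProbabilityMeasure_map (aemeasurable_pi_lambda _ hx.gaussian.aemeasurable)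
  generalize (P.map fun ω k => x k ω) = μ at hμ this ⊢
  have hwhite (ν : Measure (ℕ → ℝ)) (h : IsWhiteGaussian (fun k z => z k) N ν) :
      channelInfoRate μ ν = ENNReal.ofReal (1 / 2 * Real.logb 2 (1 + v / N)) := by
    have := h.gaussian.isProbabilityMeasure
    exact le_antisymm (channelInfoRate_le hN' hμ h.map_fin)
      (le_channelInfoRate hv' hN' hμ (h.isNoiseLaw hN'))
  obtain ⟨ν₀, hν₀⟩ := exists_isWhiteGaussian N
  have hL : channelLeakage μ N = ENNReal.ofReal (1 / 2 * Real.logb 2 (1 + v / N)) :=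
    le_antisymm ((iInf₂_le ν₀ (hν₀.isNoiseLaw hN')).trans (hwhite ν₀ hν₀).le)
      (le_iInf₂ fun ν hν => le_channelInfoRate hv' hN' hμ hν)
  exact ⟨hL, ⟨ν₀, hν₀.isNoiseLaw hN', hν₀⟩,
    fun ν h => ⟨h.isNoiseLaw hN', (hwhite ν h).trans hL.symm⟩⟩
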